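/- **Model.** Let $G=(V,E)$ be a connected static graph on $n=|V|\ge 2$ nodes and let $T$ be a set of $k\ge 1$ tokens, each of which is initially known to at least one node (the initial assignment is otherwise arbitrary). Time proceeds in synchronous rounds. In each round of *random broadcast* with *$1$-smoothing*, one edge is drawn uniformly at random from all $\binom n2$ pairs of distinct nodes and added to $G$ for this round (nothing changes if it is already present); every node that knows at least one token broadcasts a token chosen uniformly at random from the tokens it knows at the beginning of the round, and all its neighbours in the smoothed graph receive, and from then on know, that token. All random choices, within a round and in different rounds, are independent. *$k$-message broadcast is solved* once every node knows all $k$ tokens. **Theorem.** For all real numbers $a$ and $x$ there is a constant $C>0$, depending only on $a$ and $x$, such that for every such $G$, every token set of size $1\le k\le n^{a}$ and every such initial assignment, and for every integer $R\ge C\,k\sqrt n\,\log^2 n$, random broadcast with $1$-smoothing has solved $k$-message broadcast in $G$ after $R$ rounds with probability at least $1-n^{-x}$. In other words, for any number of tokens polynomial in $n$, random broadcast with $1$-smoothing solves $k$-message broadcast in a connected static graph in $O(k\sqrt n\log^2 n)$ rounds with high probability. -/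

import Mathlib

open scoped Classical in
/-- The joint law of independent choices, one for each `i`, the `i`-th one having law `p i`. -/
noncomputable def independentChoices {ι α : Type*} [Fintype ι] [Fintype α]
    (p : ι → PMF α) : PMF (ι → α) :=
  PMF.ofFintype (fun f => ∏ i, p i (f i)) (by
    have h := Finset.prod_univ_sum (fun _ : ι => (Finset.univ : Finset α)) (fun i a => p i a)
    rw [Fintype.piFinset_univ] at h
    rw [← h]
    refine Finset.prod_eq_one fun i _ => ?_
    rw [← tsum_fintype (L := SummationFilter.unconditional _)]
    exact (p i).tsum_coe)

/-- The pairs of distinct nodes, i.e. all possible edges on the node set `V`. -/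
abbrev PossibleEdge (V : Type*) : Type _ := {e : Sym2 V // ¬ e.IsDiag}

instance PossibleEdge.instNonempty (V : Type*) [Nontrivial V] : Nonempty (PossibleEdge V) := by
  obtain ⟨a, b, hab⟩ := exists_pair_ne V
  exact ⟨⟨s(a, b), by simpa using hab⟩⟩

/-- The graph `G` with the edges of the list `e` added, where an edge already present
changes nothing. -/
def addEdges {V : Type*} {l : ℕ} (G : SimpleGraph V) (e : Fin l → PossibleEdge V) :
    SimpleGraph V :=
  G ⊔ SimpleGraph.fromEdgeSet (Set.range fun i => (e i : Sym2 V))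

open scoped Classical in
/-- `l`-smoothing: `l` edges are drawn independently and uniformly (with replacement) from all
possible edges and added to the graph. -/
noncomputable def smoothing {V : Type*} [Fintype V] [Nontrivial V] (l : ℕ) (G : SimpleGraph V) :
    PMF (SimpleGraph V) :=
  (independentChoices fun _ : Fin l => PMF.uniformOfFintype (PossibleEdge V)).map (addEdges G)

/-- What a node that knows the tokens in `K` broadcasts in one round: a uniformly random token
of `K`, or nothing (`none`) if `K` is empty. -/
noncomputable def broadcastChoice {T : Type*} (K : Finset T) : PMF (Option T) :=
  if h : K.Nonempty then (PMF.uniformOfFinset K h).map some else PMF.pure none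

open scoped Classical in
/-- The tokens known after a round with communication graph `H` in which each node `u`, knowing
`S u` before the round, broadcasts `m u` to all its neighbours in `H`. -/
noncomputable def deliver {V T : Type*} [Fintype T] (H : SimpleGraph V) (m : V → Option T)
    (S : V → Finset T) : V → Finset T :=
  fun v => S v ∪ Finset.univ.filter fun t => ∃ u, H.Adj u v ∧ m u = some t

/-- One round of random broadcast in `G` with `l`-smoothing, from the token sets `S`: the fresh
random edges and the random tokens of all the nodes are independent. -/
noncomputable def randomBroadcastRound {V T : Type*} [Fintype V] [Nontrivial V] [Fintype T]
    (l : ℕ) (G : SimpleGraph V) (S : V → Finset T) : PMF (V → Finset T) :=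
  (smoothing l G).bind fun H =>
    (independentChoices fun u => broadcastChoice (S u)).map fun m => deliver H m S

/-- The law of the token sets after `r` rounds of random broadcast in the static graph `G` with
`l`-smoothing, from the initial token sets `S₀`. Each round uses fresh randomness. -/
noncomputable def randomBroadcast {V T : Type*} [Fintype V] [Nontrivial V] [Fintype T]
    (l : ℕ) (G : SimpleGraph V) (S₀ : V → Finset T) : ℕ → PMF (V → Finset T)
  | 0 => PMF.pure S₀
  | r + 1 => (randomBroadcast l G S₀ r).bind (randomBroadcastRound l G)

/-- The token sets of a solved instance: every node knows every token. -/
def BroadcastSolved {V T : Type*} (S : V → Finset T) : Prop :=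
  ∀ v t, t ∈ S v

/-! Fix one token and let A be the set of nodes knowing it, n the number of nodes, k the number of
tokens, h about √n. A knower sends the token in a round with probability at least 1/k, whatever the
past. Three effects combine. Growth (`prob_not_mem_le`): along static edges the token moves one step
closer to a given node with probability at least 1/k per round, so distance O(h) is covered in O(k(h
+ log n)) rounds. Seeding (`leads_seeding`): if |A| ≥ m and at least a quarter of the nodes lie
farther than 2h from A, the random edge carries the token to such a node with probability of order
m/(nk). By connectivity its h-ball has at least h nodes, all new to the h-neighbourhood of A. In L
of order k√n log n rounds that neighbourhood reaches 2m, unless the 2h-neighbourhood covers 3n/4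
nodes first; growth turns either outcome into knowers. Hitting (`leads_nbhd_univ`): once 3n/4 nodes
know the token, each h-ball is hit with probability at least h/(nk) per round, and growth finishes.
Growth costs about kh and hitting about (nk/h) log n, which suggests h ≈ √n. There are O(log n)
doublings of O(L) rounds each. A union bound over tokens ignores their dependence. -/

/-! ### Expectations and probabilities on finite types -/

section Mean

variable {α β : Type*} [Fintype α] [Fintype β]

/-- The expectation of a real function under a distribution on a finite type. -/
noncomputable def mean (p : PMF α) (f : α → ℝ) : ℝ := ∑ a, (p a).toReal * f a

open scoped Classical in
/-- The probability of an event under a distribution on a finite type, as a real number. -/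
noncomputable def prob (p : PMF α) (E : α → Prop) : ℝ := mean p fun a => if E a then 1 else 0

lemma mean_mono {p : PMF α} {f g : α → ℝ} (h : ∀ a, p a ≠ 0 → f a ≤ g a) :
    mean p f ≤ mean p g := by
  refine Finset.sum_le_sum fun a _ => ?_
  by_cases ha : p a = 0
  · simp [ha]
  · exact mul_le_mul_of_nonneg_left (h a ha) ENNReal.toReal_nonneg

lemma sum_toReal_eq_one (p : PMF α) : ∑ a, (p a).toReal = 1 := by
  rw [← ENNReal.toReal_sum fun a _ => p.apply_ne_top a,
    ← tsum_fintype (L := SummationFilter.unconditional _), p.tsum_coe, ENNReal.toReal_one]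

lemma mean_const (p : PMF α) (c : ℝ) : mean p (fun _ => c) = c := by
  rw [mean, ← Finset.sum_mul, sum_toReal_eq_one, one_mul]

lemma mean_add (p : PMF α) (f g : α → ℝ) :
    mean p (fun a => f a + g a) = mean p f + mean p g := by
  simp [mean, mul_add, Finset.sum_add_distrib]

lemma mean_sum {ι : Type*} (s : Finset ι) (p : PMF α) (f : ι → α → ℝ) :
    mean p (fun a => ∑ i ∈ s, f i a) = ∑ i ∈ s, mean p (f i) := by
  simp only [mean, Finset.mul_sum]
  exact Finset.sum_comm

lemma mean_const_mul (p : PMF α) (c : ℝ) (f : α → ℝ) :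
    mean p (fun a => c * f a) = c * mean p f := by
  simp only [mean, Finset.mul_sum]
  exact Finset.sum_congr rfl fun a _ => by ring

lemma mean_pure (a : α) (f : α → ℝ) : mean (PMF.pure a) f = f a := by
  classical
  rw [mean, Finset.sum_eq_single a]
  · simp
  · intro b _ hb
    simp [PMF.pure_apply, hb]
  · simp

lemma mean_bind (p : PMF α) (q : α → PMF β) (f : β → ℝ) :
    mean (p.bind q) f = mean p fun a => mean (q a) f := by
  have h (b : β) : (p.bind q b).toReal = ∑ a, (p a).toReal * (q a b).toReal := by
    rw [PMF.bind_apply, tsum_fintype, ENNReal.toReal_sum]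
    · simp
    · exact fun a _ => ENNReal.mul_ne_top (p.apply_ne_top a) ((q a).apply_ne_top b)
  simp only [mean, h, Finset.sum_mul, Finset.mul_sum]
  rw [Finset.sum_comm]
  exact Finset.sum_congr rfl fun a _ => Finset.sum_congr rfl fun b _ => by ring

lemma mean_map (p : PMF α) (g : α → β) (f : β → ℝ) :
    mean (p.map g) f = mean p fun a => f (g a) := by
  rw [← PMF.bind_pure_comp, mean_bind]
  simp [mean_pure]

lemma mean_uniformOfFintype [Nonempty α] (f : α → ℝ) :
    mean (PMF.uniformOfFintype α) f = (∑ a, f a) / Fintype.card α := by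
  simp [mean, div_eq_inv_mul, Finset.mul_sum]

lemma mean_independentChoices {ι : Type*} [Fintype ι] [DecidableEq ι] (p : ι → PMF α) (i : ι) (f : α → ℝ) :
    mean (independentChoices p) (fun c => f (c i)) = mean (p i) f := by
  -- The factor is `f` at coordinate `i` and 1 elsewhere, so every other coordinate sums to one.
  have h := Finset.prod_univ_sum (fun _ : ι => (Finset.univ : Finset α))
    (fun j a => (p j a).toReal * if j = i then f a else 1)
  rw [Fintype.piFinset_univ, Finset.prod_eq_single i] at h
  · simp only [if_true] at h
    rw [mean, mean, h]
    refine Finset.sum_congr rfl fun c _ => ?_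
    rw [Finset.prod_mul_distrib, Finset.prod_ite_eq' Finset.univ i]
    simp [independentChoices, ENNReal.toReal_prod]
  · intro j _ hj
    simp [hj, sum_toReal_eq_one]
  · simp

/-- Pointwise, `f` is at most `B` minus `δ` times the indicator of `E`. This gives the one-round
drift of every potential below. -/
lemma mean_le_sub_mul {p : PMF α} {f : α → ℝ} {E : α → Prop} {q B δ : ℝ} (hq : q ≤ prob p E)
    (hδ : 0 ≤ δ) (hB : ∀ a, p a ≠ 0 → f a ≤ B) (hE : ∀ a, p a ≠ 0 → E a → f a ≤ B - δ) :
    mean p f ≤ B - q * δ := by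
  classical
  have h : mean p f ≤ mean p (fun a => B + (-δ) * if E a then 1 else 0) := by
    refine mean_mono fun a ha => ?_
    split_ifs with h
    · linarith [hE a ha h]
    · linarith [hB a ha]
  rw [mean_add, mean_const, mean_const_mul] at h
  have h2 := mul_le_mul_of_nonneg_right hq hδ
  unfold prob at h2
  have h3 : q * δ ≤ (mean p fun a => if E a then 1 else 0) * δ := by convert h2
  linarith

lemma prob_mono {p : PMF α} {E F : α → Prop} (h : ∀ a, p a ≠ 0 → E a → F a) :
    prob p E ≤ prob p F := by
  refine mean_mono fun a ha => ?_
  split_ifs with h1 h2 h2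
  · exact le_rfl
  · exact absurd (h a ha h1) h2
  · exact zero_le_one
  · exact le_rfl

lemma prob_le_mean {p : PMF α} {E : α → Prop} {f : α → ℝ} (h0 : ∀ a, 0 ≤ f a)
    (h : ∀ a, E a → 1 ≤ f a) : prob p E ≤ mean p f := by
  refine mean_mono fun a _ => ?_
  split_ifs with h1
  exacts [h a h1, h0 a]

lemma prob_exists_le {ι : Type*} [Fintype ι] (p : PMF α) (E : ι → α → Prop) :
    prob p (fun a => ∃ i, E i a) ≤ ∑ i, prob p (E i) := by
  classical
  unfold prob
  rw [← mean_sum]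
  refine mean_mono fun a _ => ?_
  split_ifs with h1
  · obtain ⟨i, hi⟩ := h1
    refine le_trans ?_ (Finset.single_le_sum (fun j _ => ?_) (Finset.mem_univ i))
    · simp [hi]
    · split_ifs <;> norm_num
  · exact Finset.sum_nonneg fun j _ => by split_ifs <;> norm_num

lemma toOuterMeasure_eq_ofReal_prob (p : PMF α) (E : α → Prop) :
    p.toOuterMeasure {a | E a} = ENNReal.ofReal (prob p E) := by
  classical
  rw [PMF.toOuterMeasure_apply_fintype, prob, mean, ENNReal.ofReal_sum_of_nonneg]
  · refine Finset.sum_congr rfl fun a _ => ?_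
    by_cases h : E a <;> simp [h, p.apply_ne_top]
  · intro a _
    split_ifs <;> simp

lemma prob_bind (p : PMF α) (q : α → PMF β) (E : β → Prop) :
    prob (p.bind q) E = mean p fun a => prob (q a) E :=
  mean_bind _ _ _

lemma prob_map (p : PMF α) (g : α → β) (E : β → Prop) :
    prob (p.map g) E = prob p fun a => E (g a) :=
  mean_map _ _ _

lemma le_mean {p : PMF α} {f : α → ℝ} {c : ℝ}
    (h : ∀ a, p a ≠ 0 → c ≤ f a) : c ≤ mean p f :=
  (mean_const p c).symm.le.trans (mean_mono h)

lemma prob_le_one (p : PMF α) (E : α → Prop) : prob p E ≤ 1 :=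
  (mean_mono fun a _ => by split_ifs <;> norm_num).trans (mean_const p 1).le

lemma prob_bind_le {p : PMF α} {q : α → PMF β}
    {E : α → Prop} {F : β → Prop} {ε : ℝ} (hε : 0 ≤ ε) (h : ∀ a, ¬ E a → prob (q a) F ≤ ε) :
    prob (p.bind q) F ≤ prob p E + ε := by
  rw [prob_bind, prob, ← mean_const p ε, ← mean_add]
  refine mean_mono fun a _ => ?_
  split_ifs with ha
  · exact (prob_le_one _ _).trans (le_add_of_nonneg_right hε)
  · rw [zero_add]
    exact h a ha

lemma prob_nonneg (p : PMF α) (E : α → Prop) : 0 ≤ prob p E :=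
  le_mean fun a _ => by split_ifs <;> norm_num

end Mean

/-! ### One round, drift over many rounds, chaining of phases -/

section Round

open scoped Classical

variable {V T : Type*} [Fintype V] [Nontrivial V] [Fintype T]

/-- The nodes that know the token `t`. -/
noncomputable def knowers (t : T) (S : V → Finset T) : Finset V := {v | t ∈ S v}

@[simp] lemma mem_knowers {t : T} {S : V → Finset T} {v : V} : v ∈ knowers t S ↔ t ∈ S v := by
  simp [knowers]

lemma inv_card_le_prob_broadcastChoice {K : Finset T} {t : T} (ht : t ∈ K) :
    1 / (Fintype.card T : ℝ) ≤ prob (broadcastChoice K) (· = some t) := by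
  have hK : K.Nonempty := ⟨t, ht⟩
  rw [broadcastChoice, dif_pos hK, prob_map]
  have h : prob (PMF.uniformOfFinset K hK) (fun a => some a = some t) = 1 / K.card := by
    rw [prob, mean, Finset.sum_eq_single t]
    · simp [PMF.uniformOfFinset_apply_of_mem hK ht]
    · intro b _ hb
      simp [hb]
    · simp
  rw [h]
  have : 0 < K.card := hK.card_pos
  gcongr
  exact Finset.card_le_univ K

lemma inv_card_le_prob_deliver {H : SimpleGraph V} {S : V → Finset T} {u v : V} {t : T}
    (hu : t ∈ S u) (huv : H.Adj u v) :
    1 / (Fintype.card T : ℝ) ≤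
      prob (independentChoices fun u => broadcastChoice (S u)) (fun m => t ∈ deliver H m S v) := by
  refine (inv_card_le_prob_broadcastChoice hu).trans ?_
  rw [prob, ← mean_independentChoices (fun u => broadcastChoice (S u)) u]
  refine prob_mono fun m _ hm => ?_
  simp only [deliver, Finset.mem_union, Finset.mem_filter, Finset.mem_univ, true_and]
  exact Or.inr ⟨u, huv, hm⟩

lemma prob_round (G : SimpleGraph V) (S : V → Finset T) (E : (V → Finset T) → Prop) :
    prob (randomBroadcastRound 1 G S) E =
      (∑ e : PossibleEdge V, prob (independentChoices fun u => broadcastChoice (S u))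
        (fun m => E (deliver (addEdges G fun _ : Fin 1 => e) m S))) /
        Fintype.card (PossibleEdge V) := by
  have h (e : Fin 1 → PossibleEdge V) : addEdges G e = addEdges G fun _ : Fin 1 => e 0 := by
    congr 1
    exact funext fun i => congrArg e (Subsingleton.elim i 0)
  rw [randomBroadcastRound, prob_bind, smoothing, mean_map]
  simp only [prob_map]
  simp_rw [fun e : Fin 1 → PossibleEdge V => h e]
  rw [mean_independentChoices (fun _ : Fin 1 => PMF.uniformOfFintype (PossibleEdge V)) 0
    (fun e => prob (independentChoices fun u => broadcastChoice (S u))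
        (fun m => E (deliver (addEdges G fun _ : Fin 1 => e) m S))), mean_uniformOfFintype]

lemma inv_card_le_prob_round_of_adj {G : SimpleGraph V} {S : V → Finset T} {u v : V} {t : T}
    (hu : t ∈ S u) (huv : G.Adj u v) :
    1 / (Fintype.card T : ℝ) ≤ prob (randomBroadcastRound 1 G S) (fun S' => t ∈ S' v) := by
  have hc : (0 : ℝ) < Fintype.card (PossibleEdge V) := by exact_mod_cast Fintype.card_pos
  rw [prob_round, le_div_iff₀ hc, mul_comm, ← nsmul_eq_mul]
  exact Finset.card_nsmul_le_sum _ _ _ fun e _ => inv_card_le_prob_deliver hu (Or.inl huv)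

lemma card_possibleEdge_le : (Fintype.card (PossibleEdge V) : ℝ) ≤ (Fintype.card V : ℝ) ^ 2 / 2 := by
  have h : Fintype.card (PossibleEdge V) = (Fintype.card V).choose 2 := by
    rw [← Sym2.card_subtype_not_diag]
  rw [h, Nat.cast_choose_two]
  nlinarith [(Fintype.card V).cast_nonneg (α := ℝ)]

/-- Disjointness makes the pairs in A × W distinct possible edges. Each is drawn with probability at
least 2/n², and its end in A then sends the token with probability at least 1/k. -/
lemma le_prob_round_of_disjoint {G : SimpleGraph V} {S : V → Finset T} {W : Finset V} {t : T}
    (hW : Disjoint (knowers t S) W) :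
    2 * ((knowers t S).card * W.card) / (Fintype.card V ^ 2 * Fintype.card T : ℝ) ≤
      prob (randomBroadcastRound 1 G S) (fun S' => ∃ w ∈ W, t ∈ S' w) := by
  set A := knowers t S
  have hne (p : V × V) (hp : p ∈ A ×ˢ W) : p.1 ≠ p.2 := by
    rintro h
    rw [Finset.mem_product] at hp
    exact Finset.disjoint_left.mp hW hp.1 (h ▸ hp.2)
  let φ : {p // p ∈ A ×ˢ W} → PossibleEdge V := fun p =>
    ⟨s(p.1.1, p.1.2), by simpa using hne p.1 p.2⟩
  have hφ : Function.Injective φ := by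
    rintro ⟨⟨a, b⟩, hab⟩ ⟨⟨c, d⟩, hcd⟩ h
    have h' : s(a, b) = s(c, d) := congrArg Subtype.val h
    rw [Finset.mem_product] at hab hcd
    rcases Sym2.eq_iff.mp h' with ⟨rfl, rfl⟩ | ⟨rfl, rfl⟩
    · rfl
    · exact absurd hcd.2 (Finset.disjoint_left.mp hW hab.1)
  have hc : (0 : ℝ) < Fintype.card (PossibleEdge V) := by exact_mod_cast Fintype.card_pos
  rw [prob_round]
  set F : PossibleEdge V → ℝ := fun e =>
    prob (independentChoices fun u => broadcastChoice (S u))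
      (fun m => ∃ w ∈ W, t ∈ deliver (addEdges G fun _ : Fin 1 => e) m S w)
  have h1 : (A.card * W.card : ℝ) * (1 / Fintype.card T) ≤ ∑ e, F e := by
    calc (A.card * W.card : ℝ) * (1 / Fintype.card T)
        = ∑ _p : {p // p ∈ A ×ˢ W}, (1 / Fintype.card T : ℝ) := by
          simp [Finset.card_product]
      _ ≤ ∑ p, F (φ p) := by
          refine Finset.sum_le_sum fun p _ => ?_
          have hp := Finset.mem_product.mp p.2
          have hadj : (addEdges G fun _ : Fin 1 => φ p).Adj p.1.1 p.1.2 := by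
            refine Or.inr ?_
            rw [SimpleGraph.fromEdgeSet_adj]
            exact ⟨⟨0, rfl⟩, hne p.1 p.2⟩
          refine (inv_card_le_prob_deliver (mem_knowers.mp hp.1) hadj).trans ?_
          exact prob_mono fun m _ hm => ⟨_, hp.2, hm⟩
      _ = ∑ e ∈ Finset.univ.image φ, F e := by
          rw [Finset.sum_image fun a _ b _ h => hφ h]
      _ ≤ ∑ e, F e :=
          Finset.sum_le_univ_sum_of_nonneg fun e => prob_nonneg _ _
  have hn : (0 : ℝ) < Fintype.card V := by exact_mod_cast Fintype.card_pos
  calc 2 * (A.card * W.card) / (Fintype.card V ^ 2 * Fintype.card T : ℝ)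
      = (A.card * W.card : ℝ) * (1 / Fintype.card T) / (Fintype.card V ^ 2 / 2) := by
        field_simp
    _ ≤ (A.card * W.card : ℝ) * (1 / Fintype.card T) / Fintype.card (PossibleEdge V) := by
        gcongr
        exact card_possibleEdge_le
    _ ≤ _ := by gcongr

lemma subset_of_round_ne_zero {l : ℕ} {G : SimpleGraph V} {S S' : V → Finset T}
    (h : randomBroadcastRound l G S S' ≠ 0) (v : V) : S v ⊆ S' v := by
  rw [← PMF.mem_support_iff, randomBroadcastRound, PMF.mem_support_bind_iff] at h
  obtain ⟨H, -, h⟩ := h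
  rw [PMF.mem_support_map_iff] at h
  obtain ⟨m, -, rfl⟩ := h
  exact Finset.subset_union_left

lemma randomBroadcast_add (l : ℕ) (G : SimpleGraph V) (S : V → Finset T) (r s : ℕ) :
    randomBroadcast l G S (r + s) =
      (randomBroadcast l G S r).bind fun S' => randomBroadcast l G S' s := by
  induction s with
  | zero => exact (PMF.bind_pure _).symm
  | succ s ih => rw [← add_assoc, randomBroadcast, ih, PMF.bind_bind]; rfl

lemma subset_of_randomBroadcast_ne_zero {l : ℕ} {G : SimpleGraph V} {S : V → Finset T} {r : ℕ} :
    ∀ {S' : V → Finset T}, randomBroadcast l G S r S' ≠ 0 → ∀ v, S v ⊆ S' v := by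
  induction r with
  | zero =>
    intro S' h v
    rw [← PMF.mem_support_iff, randomBroadcast, PMF.mem_support_pure_iff] at h
    rw [h]
  | succ r ih =>
    intro S' h v
    rw [← PMF.mem_support_iff, randomBroadcast, PMF.mem_support_bind_iff] at h
    obtain ⟨S₁, h₁, h₂⟩ := h
    exact (ih h₁ v).trans (subset_of_round_ne_zero h₂ v)

/-- Knowledge never shrinks, so the drift is needed only at states above `S`; lower bounds on the
initial knowers thus remain available. -/
lemma mean_randomBroadcast_le {l : ℕ} {G : SimpleGraph V} {S : V → Finset T}
    {Φ : (V → Finset T) → ℝ} {ρ : ℝ} (hρ : 0 ≤ ρ)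
    (h : ∀ S', (∀ v, S v ⊆ S' v) → mean (randomBroadcastRound l G S') Φ ≤ ρ * Φ S') (r : ℕ) :
    mean (randomBroadcast l G S r) Φ ≤ ρ ^ r * Φ S := by
  induction r with
  | zero => simp [randomBroadcast, mean_pure]
  | succ r ih =>
    rw [randomBroadcast, mean_bind]
    calc _ ≤ mean (randomBroadcast l G S r) (fun S' => ρ * Φ S') :=
          mean_mono fun S' hS' => h S' (subset_of_randomBroadcast_ne_zero hS')
      _ ≤ ρ * (ρ ^ r * Φ S) := by
          rw [mean_const_mul]
          exact mul_le_mul_of_nonneg_left ih hρ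
      _ = ρ ^ (r + 1) * Φ S := by ring

/-- From every state satisfying `P`, the state after `L` rounds satisfies `Q` except with
probability at most `ε`. -/
def Leads (G : SimpleGraph V) (P Q : (V → Finset T) → Prop) (L : ℕ) (ε : ℝ) : Prop :=
  ∀ S, P S → prob (randomBroadcast 1 G S L) (fun S' => ¬ Q S') ≤ ε

lemma Leads.trans {G : SimpleGraph V} {P Q R : (V → Finset T) → Prop} {L₁ L₂ : ℕ} {ε₁ ε₂ : ℝ}
    (h₁ : Leads G P Q L₁ ε₁) (hε : 0 ≤ ε₂) (h₂ : Leads G Q R L₂ ε₂) :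
    Leads G P R (L₁ + L₂) (ε₁ + ε₂) := by
  intro S hS
  rw [randomBroadcast_add]
  exact (prob_bind_le hε fun S' hS' => h₂ S' (not_not.mp hS')).trans
    (add_le_add_left (h₁ S hS) ε₂)

lemma Leads.refl_of_imp {G : SimpleGraph V} {P Q : (V → Finset T) → Prop} {L : ℕ} {ε : ℝ}
    (hε : 0 ≤ ε) (h : ∀ S S', P S → (∀ v, S v ⊆ S' v) → Q S') : Leads G P Q L ε := by
  intro S hS
  refine le_trans ?_ hε
  rw [← mean_const (randomBroadcast 1 G S L) 0]
  refine mean_mono fun S' hS' => ?_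
  rw [if_neg (not_not.mpr (h S S' hS (subset_of_randomBroadcast_ne_zero hS')))]

end Round

/-! ### Neighbourhoods; growth, seeding and hitting -/

section Spread

open scoped Classical

variable {V : Type*} [Fintype V]

/-- The nodes at distance at most `j` from `A`. -/
noncomputable def nbhd (G : SimpleGraph V) (j : ℕ) (A : Finset V) : Finset V :=
  {v | ∃ u ∈ A, G.dist u v ≤ j}

@[simp] lemma mem_nbhd {G : SimpleGraph V} {j : ℕ} {A : Finset V} {v : V} :
    v ∈ nbhd G j A ↔ ∃ u ∈ A, G.dist u v ≤ j := by
  simp [nbhd]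

lemma subset_nbhd (G : SimpleGraph V) (j : ℕ) (A : Finset V) : A ⊆ nbhd G j A :=
  fun v hv => mem_nbhd.mpr ⟨v, hv, by simp⟩

lemma nbhd_subset_nbhd (G : SimpleGraph V) {i j : ℕ} {A B : Finset V} (hij : i ≤ j) (h : A ⊆ B) :
    nbhd G i A ⊆ nbhd G j B := fun v hv => by
  obtain ⟨u, hu, huv⟩ := mem_nbhd.mp hv
  exact mem_nbhd.mpr ⟨u, h hu, huv.trans hij⟩

/-- A ball that equals the next larger one is closed under adjacency, hence everything; until then
each radius adds a node. -/
lemma nbhd_singleton_card_or_eq_univ {G : SimpleGraph V} (hG : G.Connected) (u : V) (j : ℕ) :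
    j + 1 ≤ (nbhd G j {u}).card ∨ nbhd G j {u} = Finset.univ := by
  induction j with
  | zero =>
    exact Or.inl (Finset.card_pos.mpr ⟨u, subset_nbhd G 0 {u} (Finset.mem_singleton_self u)⟩)
  | succ j ih =>
    have hsub : nbhd G j {u} ⊆ nbhd G (j + 1) {u} := nbhd_subset_nbhd G j.le_succ subset_rfl
    by_cases heq : nbhd G j {u} = nbhd G (j + 1) {u}
    · right
      rw [Finset.eq_univ_iff_forall]
      intro v
      have hclosed (a b : V) (p : G.Walk a b) :
          a ∈ nbhd G (j + 1) {u} → b ∈ nbhd G (j + 1) {u} := by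
        induction p with
        | nil => exact id
        | cons hadj _ ihp =>
          intro ha
          refine ihp ?_
          rw [← heq] at ha
          simp only [mem_nbhd, Finset.mem_singleton, exists_eq_left] at ha ⊢
          have h1 := hG.dist_triangle (u := u) (v := _) (w := _) |>.trans
            (add_le_add ha (SimpleGraph.dist_eq_one_iff_adj.mpr hadj).le)
          exact h1
      obtain ⟨p⟩ := hG.preconnected u v
      exact hclosed u v p (subset_nbhd G _ _ (Finset.mem_singleton_self u))
    · rcases ih with h | h
      · left
        have := Finset.card_lt_card (lt_of_le_of_ne hsub heq)
        omega
      · exact Or.inr (Finset.univ_subset_iff.mp (h ▸ hsub))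

lemma le_card_nbhd_singleton {G : SimpleGraph V} (hG : G.Connected) (u : V) {j : ℕ}
    (hj : j ≤ Fintype.card V) : j ≤ (nbhd G j {u}).card := by
  rcases nbhd_singleton_card_or_eq_univ hG u j with h | h
  · omega
  · rwa [h, Finset.card_univ]

/-- The distance from the set `A` to the node `v`. -/
noncomputable def distTo (G : SimpleGraph V) (A : Finset V) (v : V) : ℕ :=
  sInf ((fun u => G.dist u v) '' (A : Set V))

lemma distTo_le {G : SimpleGraph V} {A : Finset V} {u v : V} (hu : u ∈ A) :
    distTo G A v ≤ G.dist u v :=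
  Nat.sInf_le ⟨u, hu, rfl⟩

lemma exists_dist_eq_distTo (G : SimpleGraph V) {A : Finset V} (hA : A.Nonempty) (v : V) :
    ∃ u ∈ A, G.dist u v = distTo G A v := by
  obtain ⟨u, hu⟩ := hA
  exact Nat.sInf_mem (s := (fun u => G.dist u v) '' (A : Set V)) ⟨_, u, hu, rfl⟩

/-- Nonemptiness matters: the infimum over the empty set is 0 by default. -/
lemma distTo_anti {G : SimpleGraph V} {A B : Finset V} (hA : A.Nonempty) (h : A ⊆ B) (v : V) :
    distTo G B v ≤ distTo G A v := by
  obtain ⟨u, hu, huv⟩ := exists_dist_eq_distTo G hA v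
  exact huv ▸ distTo_le (h hu)

lemma exists_adj_dist_lt {G : SimpleGraph V} (hG : G.Connected) {A : Finset V} (hA : A.Nonempty)
    {v : V} (hv : v ∉ A) : ∃ u ∈ A, ∃ w, G.Adj u w ∧ G.dist w v + 1 ≤ distTo G A v := by
  obtain ⟨u, hu, huv⟩ := exists_dist_eq_distTo G hA v
  obtain ⟨p, hp⟩ := hG.exists_walk_length_eq_dist u v
  cases p with
  | nil => exact absurd hu hv
  | cons hadj p =>
    refine ⟨u, hu, _, hadj, ?_⟩
    rw [SimpleGraph.Walk.length_cons] at hp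
    have := SimpleGraph.dist_le p
    omega

variable [Nontrivial V] {T : Type*} [Fintype T]

lemma knowers_mono {t : T} {S S' : V → Finset T} (h : ∀ v, S v ⊆ S' v) :
    knowers t S ⊆ knowers t S' := fun v hv => by
  rw [mem_knowers] at hv ⊢
  exact h v hv

/-- The potential is 2 to the distance from the knowers to `v`, and 0 once `v` knows. With
probability at least 1/k the next node on a shortest path learns `t`, which at least halves it, so
its mean shrinks by the factor 1 - 1/(2k). Markov's inequality concludes. -/
lemma prob_not_mem_le {G : SimpleGraph V} (hG : G.Connected) {t : T} {S : V → Finset T} {j : ℕ}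
    {v : V} (hv : v ∈ nbhd G j (knowers t S)) (L : ℕ) :
    prob (randomBroadcast 1 G S L) (fun S' => ¬ t ∈ S' v) ≤
      Real.exp (-(1 / (2 * Fintype.card T))) ^ L * 2 ^ j := by
  set Φ : (V → Finset T) → ℝ := fun S' => if t ∈ S' v then 0 else 2 ^ distTo G (knowers t S') v
    with hΦ
  obtain ⟨u₀, hu₀, hu₀v⟩ := mem_nbhd.mp hv
  have hΦS : Φ S ≤ 2 ^ j := by
    simp only [hΦ]
    split_ifs
    · positivity
    · exact pow_le_pow_right₀ (by norm_num) ((distTo_le hu₀).trans hu₀v)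
  refine (prob_le_mean (f := Φ) (fun S' => ?_) fun S' hS' => ?_).trans ?_
  · simp only [hΦ]
    split_ifs <;> positivity
  · simp only [hΦ, if_neg hS']
    exact one_le_pow₀ (by norm_num)
  refine (mean_randomBroadcast_le (Real.exp_nonneg _) (fun S₁ hS₁ => ?_) L).trans
    (mul_le_mul_of_nonneg_left hΦS (by positivity))
  have hne : (knowers t S₁).Nonempty := ⟨u₀, knowers_mono hS₁ hu₀⟩
  by_cases hv₁ : t ∈ S₁ v
  · have hΦ₁ : Φ S₁ = 0 := if_pos hv₁
    rw [hΦ₁, mul_zero, ← mean_const (randomBroadcastRound 1 G S₁) 0]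
    refine mean_mono fun S₂ hS₂ => ?_
    simp only [hΦ]
    rw [if_pos (subset_of_round_ne_zero hS₂ v hv₁)]
  · obtain ⟨u, hu, w, huw, hwv⟩ := exists_adj_dist_lt hG hne (v := v) (by simpa using hv₁)
    have hq := inv_card_le_prob_round_of_adj (mem_knowers.mp hu) huw
    have hΦ₁ : Φ S₁ = 2 ^ distTo G (knowers t S₁) v := if_neg hv₁
    rw [hΦ₁]
    set d := distTo G (knowers t S₁) v
    have hstep := mean_le_sub_mul (f := Φ) (B := 2 ^ d) (δ := 2 ^ d / 2) hq (by positivity)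
      (fun S₂ hS₂ => ?_) (fun S₂ hS₂ hw => ?_)
    · refine hstep.trans ?_
      have := Real.one_sub_le_exp_neg (1 / (2 * Fintype.card T))
      calc (2 : ℝ) ^ d - 1 / Fintype.card T * (2 ^ d / 2)
          = (1 - 1 / (2 * Fintype.card T)) * 2 ^ d := by ring
        _ ≤ _ := by gcongr
    · simp only [hΦ]
      split_ifs
      · positivity
      · exact pow_le_pow_right₀ (by norm_num)
          (distTo_anti hne (knowers_mono (subset_of_round_ne_zero hS₂)) v)
    · simp only [hΦ]
      split_ifs
      · rw [sub_half]
        positivity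
      · have h1 : distTo G (knowers t S₂) v + 1 ≤ d :=
          (Nat.succ_le_succ (distTo_le (mem_knowers.mpr hw))).trans hwv
        have h2 : (2 : ℝ) ^ (distTo G (knowers t S₂) v + 1) ≤ 2 ^ d :=
          pow_le_pow_right₀ (by norm_num) h1
        rw [pow_succ] at h2
        linarith

/-- Converts what holds of a neighbourhood into what holds of the knowers themselves, by a union
bound over its nodes. -/
lemma leads_of_nbhd {G : SimpleGraph V} (hG : G.Connected) {t : T} {j : ℕ}
    {P : Finset V → Prop} (hP : ∀ A B, A ⊆ B → P A → P B) (L : ℕ) :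
    Leads G (fun S => P (nbhd G j (knowers t S))) (fun S => P (knowers t S)) L
      (Fintype.card V * (Real.exp (-(1 / (2 * Fintype.card T))) ^ L * 2 ^ j)) := by
  intro S hS
  have h : prob (randomBroadcast 1 G S L) (fun S' => ¬ P (knowers t S')) ≤
      prob (randomBroadcast 1 G S L)
        (fun S' => ∃ v : {v // v ∈ nbhd G j (knowers t S)}, ¬ t ∈ S' v) := by
    refine prob_mono fun S' _ hS' => ?_
    by_contra! hall
    exact hS' (hP _ _ (fun v hv => mem_knowers.mpr (hall ⟨v, hv⟩)) hS)
  refine h.trans ((prob_exists_le _ _).trans ?_)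
  refine (Finset.sum_le_sum fun v _ => prob_not_mem_le hG v.2 L).trans ?_
  rw [Finset.sum_const, nsmul_eq_mul]
  gcongr
  simpa using Finset.card_le_univ (nbhd G j (knowers t S))

lemma le_card_nbhd_of_far {G : SimpleGraph V} (hG : G.Connected) {A B : Finset V} {w : V} {h : ℕ}
    (hh : h ≤ Fintype.card V) (hAB : A ⊆ B) (hwB : w ∈ B) (hwA : w ∉ nbhd G (2 * h) A) :
    (nbhd G h A).card + h ≤ (nbhd G h B).card := by
  have hdisj : Disjoint (nbhd G h A) (nbhd G h {w}) := by
    rw [Finset.disjoint_left]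
    intro x hxA hxw
    obtain ⟨u, hu, hux⟩ := mem_nbhd.mp hxA
    simp only [mem_nbhd, Finset.mem_singleton, exists_eq_left] at hxw
    refine hwA (mem_nbhd.mpr ⟨u, hu, ?_⟩)
    have h1 := hG.dist_triangle (u := u) (v := x) (w := w)
    rw [SimpleGraph.dist_comm (u := x)] at h1
    omega
  calc (nbhd G h A).card + h ≤ (nbhd G h A).card + (nbhd G h {w}).card :=
        Nat.add_le_add_left (le_card_nbhd_singleton hG w hh) _
    _ = (nbhd G h A ∪ nbhd G h {w}).card := (Finset.card_union_of_disjoint hdisj).symm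
    _ ≤ (nbhd G h B).card := Finset.card_le_card (Finset.union_subset
        (nbhd_subset_nbhd G le_rfl hAB)
        (nbhd_subset_nbhd G le_rfl (Finset.singleton_subset_iff.mpr hwB)))

/-- The potential is exp(-|N_h(A)|/h), set to 0 once the 2h-neighbourhood is large. Before that, a
far node is reached with probability at least m/(2nk), adding h nodes to N_h(A). -/
lemma leads_seeding {G : SimpleGraph V} (hG : G.Connected) {t : T} {h : ℕ} (h0 : 0 < h)
    (hh : h ≤ Fintype.card V) {m : ℝ} (hm : 0 ≤ m) (L : ℕ) :
    Leads G (fun S => m ≤ (knowers t S).card)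
      (fun S => 3 * (Fintype.card V : ℝ) ≤ 4 * (nbhd G (2 * h) (knowers t S)).card ∨
        2 * m ≤ (nbhd G h (knowers t S)).card) L
      (Real.exp (2 * m / h) *
        Real.exp (-(m / (4 * Fintype.card V * Fintype.card T))) ^ L) := by
  intro S hS
  set n : ℝ := (Fintype.card V : ℝ) with hn
  set k : ℝ := (Fintype.card T : ℝ) with hk
  have hn0 : 0 < n := by rw [hn]; exact_mod_cast Fintype.card_pos
  have hh0 : (0 : ℝ) < h := by exact_mod_cast h0
  set Φ : (V → Finset T) → ℝ := fun S' =>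
    if 3 * n ≤ 4 * (nbhd G (2 * h) (knowers t S')).card then 0
    else Real.exp (-((nbhd G h (knowers t S')).card / h)) with hΦ
  have hΦ0 (S') : 0 ≤ Φ S' := by
    simp only [hΦ]
    split_ifs <;> positivity
  have hΦS : Φ S ≤ 1 := by
    simp only [hΦ]
    split_ifs
    · exact zero_le_one
    · rw [Real.exp_le_one_iff, neg_nonpos]
      positivity
  -- On failure |N_h(A)| < 2m, so the factor exp(2m/h) lifts the potential to at least 1.
  refine (prob_le_mean (f := fun S' => Real.exp (2 * m / h) * Φ S')
    (fun S' => mul_nonneg (Real.exp_nonneg _) (hΦ0 S')) fun S' hS' => ?_).trans ?_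
  · rw [not_or, not_le, not_le] at hS'
    simp only [hΦ]
    rw [if_neg (not_le.mpr hS'.1), ← Real.exp_add, Real.one_le_exp_iff, ← sub_eq_add_neg,
      ← sub_div]
    exact div_nonneg (sub_nonneg.mpr hS'.2.le) hh0.le
  rw [mean_const_mul]
  refine mul_le_mul_of_nonneg_left ?_ (Real.exp_nonneg _)
  refine (mean_randomBroadcast_le (Real.exp_nonneg _) (fun S₁ hS₁ => ?_) L).trans
    (mul_le_of_le_one_right (by positivity) hΦS)
  by_cases hfull : 3 * n ≤ 4 * (nbhd G (2 * h) (knowers t S₁)).card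
  · have hΦ₁ : Φ S₁ = 0 := if_pos hfull
    rw [hΦ₁, mul_zero, ← mean_const (randomBroadcastRound 1 G S₁) 0]
    refine mean_mono fun S₂ hS₂ => ?_
    simp only [hΦ]
    rw [if_pos]
    refine hfull.trans ?_
    gcongr
    exact nbhd_subset_nbhd G le_rfl (knowers_mono (subset_of_round_ne_zero hS₂))
  · set A := knowers t S₁
    set W := (nbhd G (2 * h) A)ᶜ
    have hmA : m ≤ A.card := hS.trans (by gcongr; exact knowers_mono hS₁)
    have hW : n ≤ 4 * W.card := by
      have h1 : (nbhd G (2 * h) A).card + W.card = Fintype.card V :=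
        Finset.card_add_card_compl _
      have h2 : ((nbhd G (2 * h) A).card : ℝ) + W.card = n := by rw [hn]; exact_mod_cast h1
      linarith [not_le.mp hfull]
    have hdisj : Disjoint A W := by
      rw [Finset.disjoint_left]
      intro x hx hxW
      exact Finset.mem_compl.mp hxW (subset_nbhd G _ _ hx)
    have hq : m / (2 * n * k) ≤
        prob (randomBroadcastRound 1 G S₁) (fun S' => ∃ w ∈ W, t ∈ S' w) := by
      refine le_trans ?_ (le_prob_round_of_disjoint hdisj)
      calc m / (2 * n * k) = 2 * (m * (n / 4)) / (n ^ 2 * k) := by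
            field_simp
            ring
        _ ≤ 2 * (A.card * W.card) / (n ^ 2 * k) := by
            gcongr
            linarith
    have hΦ₁ : Φ S₁ = Real.exp (-((nbhd G h A).card / h)) := if_neg hfull
    rw [hΦ₁]
    -- Gaining `h` nodes multiplies the potential by at most exp(-1) ≤ 1/2, whence δ = B/2.
    set B := Real.exp (-((nbhd G h A).card / h))
    have hstep := mean_le_sub_mul (f := Φ) (B := B) (δ := B / 2) hq (by positivity)
      (fun S₂ hS₂ => ?_) (fun S₂ hS₂ hw => ?_)
    · refine hstep.trans ?_
      have := Real.one_sub_le_exp_neg (m / (4 * n * k))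
      calc B - m / (2 * n * k) * (B / 2) = (1 - m / (4 * n * k)) * B := by ring
        _ ≤ _ := by gcongr
    · simp only [hΦ]
      split_ifs
      · positivity
      · refine Real.exp_le_exp.mpr ?_
        gcongr
        exact nbhd_subset_nbhd G le_rfl (knowers_mono (subset_of_round_ne_zero hS₂))
    · simp only [hΦ]
      split_ifs
      · rw [sub_half]
        positivity
      · obtain ⟨w, hwW, hw⟩ := hw
        have h1 := le_card_nbhd_of_far hG hh (knowers_mono (t := t) (subset_of_round_ne_zero hS₂))
          (mem_knowers.mpr hw) (Finset.mem_compl.mp hwW)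
        have h2 : ((nbhd G h A).card : ℝ) + h ≤ (nbhd G h (knowers t S₂)).card := by
          exact_mod_cast h1
        have h3 : Real.exp (-((nbhd G h (knowers t S₂)).card / h)) ≤ B * Real.exp (-1) := by
          rw [← Real.exp_add]
          refine Real.exp_le_exp.mpr ?_
          rw [← neg_add, neg_le_neg_iff, ← div_self hh0.ne', ← add_div]
          gcongr
        have h4 : Real.exp (-1) ≤ 1 / 2 := by
          rw [Real.exp_neg, ← one_div]
          exact one_div_le_one_div_of_le two_pos (by linarith [Real.add_one_le_exp 1])
        have h5 : B * Real.exp (-1) ≤ B * (1 / 2) :=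
          mul_le_mul_of_nonneg_left h4 (Real.exp_nonneg _)
        linarith

lemma leads_nbhd_univ {G : SimpleGraph V} (hG : G.Connected) {t : T} {h : ℕ}
    (hh : h ≤ Fintype.card V) (L : ℕ) :
    Leads G (fun S => 3 * (Fintype.card V : ℝ) ≤ 4 * (knowers t S).card)
      (fun S => ∀ v, v ∈ nbhd G h (knowers t S)) L
      (Fintype.card V * Real.exp (-(h / (Fintype.card V * Fintype.card T))) ^ L) := by
  intro S hS
  set n : ℝ := (Fintype.card V : ℝ) with hn
  set k : ℝ := (Fintype.card T : ℝ) with hk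
  have hn0 : 0 < n := by rw [hn]; exact_mod_cast Fintype.card_pos
  simp only [not_forall]
  refine (prob_exists_le _ _).trans ?_
  refine (Finset.sum_le_card_nsmul _ _ _ fun v _ => ?_).trans
    (by rw [Finset.card_univ, nsmul_eq_mul])
  set Φ : (V → Finset T) → ℝ := fun S' => if v ∈ nbhd G h (knowers t S') then 0 else 1 with hΦ
  have hΦ1 (S') : Φ S' ≤ 1 := by
    simp only [hΦ]
    split_ifs <;> norm_num
  refine (prob_le_mean (f := Φ) (fun S' => ?_) fun S' hS' => ?_).trans ?_
  · simp only [hΦ]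
    split_ifs <;> norm_num
  · simp only [hΦ, if_neg hS', le_refl]
  refine (mean_randomBroadcast_le (Real.exp_nonneg _) (fun S₁ hS₁ => ?_) L).trans
    (mul_le_of_le_one_right (by positivity) (hΦ1 S))
  set A := knowers t S₁
  by_cases hv : v ∈ nbhd G h A
  · have hΦ₁ : Φ S₁ = 0 := if_pos hv
    rw [hΦ₁, mul_zero, ← mean_const (randomBroadcastRound 1 G S₁) 0]
    refine mean_mono fun S₂ hS₂ => ?_
    simp only [hΦ]
    rw [if_pos (nbhd_subset_nbhd G le_rfl (knowers_mono (subset_of_round_ne_zero hS₂)) hv)]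
  · have hΦ₁ : Φ S₁ = 1 := if_neg hv
    rw [hΦ₁, mul_one]
    set W := nbhd G h {v}
    have hW : (h : ℝ) ≤ W.card := by exact_mod_cast le_card_nbhd_singleton hG v hh
    have hA : 3 * n ≤ 4 * A.card := hS.trans (by gcongr; exact knowers_mono hS₁)
    have hdisj : Disjoint A W := by
      rw [Finset.disjoint_left]
      intro x hx hxW
      simp only [W, mem_nbhd, Finset.mem_singleton, exists_eq_left] at hxW
      exact hv (mem_nbhd.mpr ⟨x, hx, by rwa [SimpleGraph.dist_comm]⟩)
    have hq : h / (n * k) ≤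
        prob (randomBroadcastRound 1 G S₁) (fun S' => ∃ w ∈ W, t ∈ S' w) := by
      refine le_trans ?_ (le_prob_round_of_disjoint hdisj)
      -- Only n/2 of the 3n/4 knowers are used.
      calc h / (n * k) = 2 * (n / 2 * h) / (n ^ 2 * k) := by
            field_simp
        _ ≤ 2 * (A.card * W.card) / (n ^ 2 * k) := by
            gcongr
            linarith
    have hstep := mean_le_sub_mul (f := Φ) (B := 1) (δ := 1) hq zero_le_one
      (fun S₂ _ => hΦ1 S₂) (fun S₂ _ hw => ?_)
    · rw [mul_one] at hstep
      exact hstep.trans (Real.one_sub_le_exp_neg _)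
    · obtain ⟨w, hwW, hw⟩ := hw
      simp only [W, mem_nbhd, Finset.mem_singleton, exists_eq_left] at hwW
      simp only [hΦ]
      rw [if_pos (mem_nbhd.mpr ⟨w, mem_knowers.mpr hw, by rwa [SimpleGraph.dist_comm]⟩), sub_self]

end Spread

/-! ### Doubling phases and the spread of one token -/

section Phases

variable {V T : Type*} [Fintype V] [Nontrivial V] [Fintype T]

lemma Leads.mono {G : SimpleGraph V} {P Q : (V → Finset T) → Prop} {L : ℕ} {ε δ : ℝ}
    (h : Leads G P Q L ε) (hεδ : ε ≤ δ) : Leads G P Q L δ :=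
  fun S hS => (h S hS).trans hεδ

lemma leads_doubling {G : SimpleGraph V} (hG : G.Connected) {t : T} {h L : ℕ} (h0 : 0 < h)
    (hh : h ≤ Fintype.card V) {m ε : ℝ} (hm : 0 ≤ m) (hε : 0 ≤ ε)
    (hgrow : Fintype.card V * (Real.exp (-(1 / (2 * Fintype.card T))) ^ L * 2 ^ (2 * h)) ≤ ε)
    (hseed : Real.exp (2 * m / h) *
        Real.exp (-(m / (4 * Fintype.card V * Fintype.card T))) ^ L ≤ ε) :
    Leads G
      (fun S => 3 * (Fintype.card V : ℝ) ≤ 4 * (knowers t S).card ∨ m ≤ (knowers t S).card)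
      (fun S => 3 * (Fintype.card V : ℝ) ≤ 4 * (knowers t S).card ∨ 2 * m ≤ (knowers t S).card)
      (L + L) (ε + ε) := by
  intro S hS
  rcases hS with hS | hS
  · refine Leads.refl_of_imp
      (P := fun S => 3 * (Fintype.card V : ℝ) ≤ 4 * (knowers t S).card)
      (by positivity) (fun S S' hS hSS' => Or.inl ?_) S hS
    refine le_trans hS ?_
    gcongr
    exact knowers_mono hSS'
  · have h1 := (leads_seeding (t := t) hG h0 hh hm L).mono hseed
    have h2 := (leads_of_nbhd (t := t) (j := 2 * h) hG (P := fun B =>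
      3 * (Fintype.card V : ℝ) ≤ 4 * B.card ∨ 2 * m ≤ B.card) (fun A B hAB hA => by
        have : (A.card : ℝ) ≤ B.card := by exact_mod_cast Finset.card_le_card hAB
        exact hA.imp (fun _ => by linarith) fun _ => by linarith) L).mono hgrow
    refine h1.trans hε (fun S₁ hS₁ => h2 S₁ ?_) S hS
    refine hS₁.imp_right fun h3 => h3.trans ?_
    gcongr
    exact nbhd_subset_nbhd G (by omega) subset_rfl

/-- The 2i + 3 blocks of `L` rounds: one growth block to get `h` knowers, two (seeding, growth) per
doubling, then one hitting and one growth block. -/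
lemma leads_known {G : SimpleGraph V} (hG : G.Connected) {t : T} {h L i : ℕ} (h0 : 0 < h)
    (hh : h ≤ Fintype.card V) (hi : Fintype.card V ≤ 2 ^ i) {ε : ℝ} (hε : 0 ≤ ε)
    (hgrow : Fintype.card V * (Real.exp (-(1 / (2 * Fintype.card T))) ^ L * 2 ^ (2 * h)) ≤ ε)
    (hseed : ∀ m : ℝ, h ≤ m → Real.exp (2 * m / h) *
        Real.exp (-(m / (4 * Fintype.card V * Fintype.card T))) ^ L ≤ ε)
    (hhit : Fintype.card V * Real.exp (-(h / (Fintype.card V * Fintype.card T))) ^ L ≤ ε) :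
    Leads G (fun S => ∃ v, t ∈ S v) (fun S => ∀ v, t ∈ S v) ((2 * i + 3) * L)
      ((2 * i + 3) * ε) := by
  have hgrow' : Fintype.card V * (Real.exp (-(1 / (2 * Fintype.card T))) ^ L * 2 ^ h) ≤ ε := by
    refine le_trans ?_ hgrow
    gcongr
    · norm_num
    · omega
  have hphase (j : ℕ) : Leads G (fun S => ∃ v, t ∈ S v)
      (fun S => 3 * (Fintype.card V : ℝ) ≤ 4 * (knowers t S).card ∨
        2 ^ j * (h : ℝ) ≤ (knowers t S).card) ((2 * j + 1) * L) ((2 * j + 1) * ε) := by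
    induction j with
    | zero =>
      intro S ⟨v, hv⟩
      have h1 := (leads_of_nbhd (t := t) (j := h) hG (P := fun B =>
        3 * (Fintype.card V : ℝ) ≤ 4 * B.card ∨ 2 ^ 0 * (h : ℝ) ≤ B.card) (fun A B hAB hA => by
          have : (A.card : ℝ) ≤ B.card := by exact_mod_cast Finset.card_le_card hAB
          exact hA.imp (fun _ => by linarith) fun _ => by linarith) L).mono hgrow' S (Or.inr ?_)
      · simpa using h1
      · rw [pow_zero, one_mul, Nat.cast_le]
        refine (le_card_nbhd_singleton hG v hh).trans (Finset.card_le_card ?_)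
        exact nbhd_subset_nbhd G le_rfl (Finset.singleton_subset_iff.mpr (mem_knowers.mpr hv))
    | succ j ih =>
      have hm : (h : ℝ) ≤ 2 ^ j * h := le_mul_of_one_le_left h.cast_nonneg
        (one_le_pow₀ (by norm_num))
      have h1 := ih.trans (by positivity) (leads_doubling hG h0 hh (by positivity) hε hgrow
        (hseed _ hm))
      have e1 : (2 * j + 1) * L + (L + L) = (2 * (j + 1) + 1) * L := by ring
      have e2 : (2 * j + 1) * ε + (ε + ε) = (2 * ((j + 1 : ℕ) : ℝ) + 1) * ε := by
        push_cast
        ring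
      have e3 : 2 * (2 ^ j * (h : ℝ)) = 2 ^ (j + 1) * h := by ring
      rwa [e1, e2, e3] at h1
  have hfinal : Leads G (fun S => 3 * (Fintype.card V : ℝ) ≤ 4 * (knowers t S).card)
      (fun S => ∀ v, t ∈ S v) (L + L) (ε + ε) := by
    refine ((leads_nbhd_univ (t := t) hG hh L).mono hhit).trans hε ?_
    have h2 := (leads_of_nbhd (t := t) (j := h) hG (P := fun B => ∀ v, v ∈ B)
      (fun A B hAB hA v => hAB (hA v)) L).mono hgrow'
    simpa only [mem_knowers] using h2
  have h1 := (hphase i).trans (by positivity) (fun S hS => hfinal S ?_)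
  · have e1 : (2 * i + 1) * L + (L + L) = (2 * i + 3) * L := by ring
    have e2 : (2 * i + 1) * ε + (ε + ε) = (2 * (i : ℝ) + 3) * ε := by ring
    rwa [e1, e2] at h1
  · refine hS.elim id fun hS => ?_
    have h3 : (Fintype.card V : ℝ) ≤ 2 ^ i := by exact_mod_cast hi
    have h4 : (1 : ℝ) ≤ h := by exact_mod_cast h0
    have h5 : (Fintype.card V : ℝ) ≤ 2 ^ i * h :=
      h3.trans (le_mul_of_one_le_right (by positivity) h4)
    linarith

open scoped Classical in
lemma prob_not_broadcastSolved_le {G : SimpleGraph V} {S : V → Finset T} {L R : ℕ} {ε : ℝ}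
    (hS : ∀ t, ∃ v, t ∈ S v) (hLR : L ≤ R)
    (h : ∀ t : T, Leads G (fun S => ∃ v, t ∈ S v) (fun S => ∀ v, t ∈ S v) L ε) :
    prob (randomBroadcast 1 G S R) (fun S' => ¬ BroadcastSolved S') ≤ Fintype.card T * ε := by
  have h1 (t : T) : prob (randomBroadcast 1 G S R) (fun S' => ¬ ∀ v, t ∈ S' v) ≤ ε := by
    have h2 := (h t).trans le_rfl (Leads.refl_of_imp (L := R - L) le_rfl
      fun S₁ S₂ h3 h4 v => h4 v (h3 v)) S (hS t)
    rwa [Nat.add_sub_cancel' hLR, add_zero] at h2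
  refine (prob_mono fun S' _ hS' => ?_).trans ((prob_exists_le _ _).trans
    ((Finset.sum_le_card_nsmul _ _ _ fun t _ => h1 t).trans
      (by rw [Finset.card_univ, nsmul_eq_mul])))
  by_contra! hall
  exact hS' fun v t => hall t v

end Phases

/-! ### Numerical estimates for the block length -/

section Bounds

variable {n k y : ℝ} {h L : ℕ}

/-- The exponent L/(2k) ≥ (8y + 20)√n log n must beat 2h ≤ 2√n, using 2 ≤ e, plus y log n. -/
lemma growth_bound (hk : 1 ≤ k) (hy : 0 ≤ y) (hn : 2 ≤ n) (hh : (h : ℝ) ≤ √n)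
    (hL : (16 * y + 40) * (k * √n * Real.log n) ≤ L) :
    Real.exp (-(1 / (2 * k))) ^ L * 2 ^ (2 * h) ≤ n ^ (-y) := by
  have hl : 1 / 2 ≤ Real.log n := by
    linarith [Real.log_two_gt_d9, Real.log_le_log two_pos hn]
  have hs : 1 ≤ √n := Real.one_le_sqrt.mpr (by linarith)
  have h2 : (2 : ℝ) ^ (2 * h) ≤ Real.exp (2 * h) := by
    have h3 : (2 : ℝ) ≤ Real.exp 1 := by linarith [Real.add_one_le_exp 1]
    have h4 := pow_le_pow_left₀ zero_le_two h3 (2 * h)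
    rw [← Real.exp_nat_mul] at h4
    simpa using h4
  rw [← Real.exp_nat_mul, Real.rpow_def_of_pos (by linarith)]
  refine (mul_le_mul_of_nonneg_left h2 (Real.exp_nonneg _)).trans ?_
  rw [← Real.exp_add]
  refine Real.exp_le_exp.mpr ?_
  have h5 : (8 * y + 20) * (√n * Real.log n) ≤ L * (1 / (2 * k)) := by
    rw [mul_one_div, le_div_iff₀ (by positivity)]
    linarith
  have h6 : √n ≤ 2 * (√n * Real.log n) := by nlinarith
  have h7 : Real.log n ≤ √n * Real.log n := by nlinarith
  have h8 : y * Real.log n ≤ y * (√n * Real.log n) := mul_le_mul_of_nonneg_left h7 hy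
  have h9 : 0 ≤ y * (√n * Real.log n) := by positivity
  linarith

/-- Both the gain, at least (4y + 10) log n · m/√n, and the loss 2m/h ≤ 4m/√n scale with `m`; m ≥ h
≥ √n/2 leaves y log n to spare. -/
lemma seeding_bound (hk : 1 ≤ k) (hy : 0 ≤ y) (hn : 2 ≤ n) (hh : √n ≤ 2 * h)
    (hL : (16 * y + 40) * (k * √n * Real.log n) ≤ L) {m : ℝ} (hm : h ≤ m) :
    Real.exp (2 * m / h) * Real.exp (-(m / (4 * n * k))) ^ L ≤ n ^ (-y) := by
  have hl : 1 / 2 ≤ Real.log n := by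
    linarith [Real.log_two_gt_d9, Real.log_le_log two_pos hn]
  have hs : 1 ≤ √n := Real.one_le_sqrt.mpr (by linarith)
  have hsq : √n * √n = n := Real.mul_self_sqrt (by linarith)
  have hh0 : (0 : ℝ) < h := by linarith
  have hm0 : 0 < m := by linarith
  rw [← Real.exp_nat_mul, Real.rpow_def_of_pos (by linarith), ← Real.exp_add]
  refine Real.exp_le_exp.mpr ?_
  have h1 : 2 * m / h ≤ 4 * (m / √n) := by
    rw [mul_div_assoc', div_le_div_iff₀ hh0 (by linarith)]
    nlinarith
  have h2 : (4 * y + 10) * Real.log n * (m / √n) ≤ L * (m / (4 * n * k)) := by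
    have h3 : (4 * y + 10) * Real.log n * (m / √n) =
        (16 * y + 40) * (k * √n * Real.log n) * (m / (4 * n * k)) := by
      -- With n = s·s the identity becomes rational in `s`.
      generalize Real.log n = l
      generalize √n = s at hs hsq ⊢
      subst hsq
      field_simp
      ring
    rw [h3]
    gcongr
  have h4 : 1 / 2 ≤ m / √n := by
    rw [le_div_iff₀ (by linarith)]
    linarith
  have h5 : m / √n ≤ 2 * (Real.log n * (m / √n)) := by nlinarith
  have h6 : y * Real.log n ≤ 2 * (y * (Real.log n * (m / √n))) := by
    have : 0 ≤ y * Real.log n := by positivity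
    nlinarith
  have h7 : 0 ≤ y * (Real.log n * (m / √n)) := by positivity
  have h8 : 0 ≤ Real.log n * (m / √n) := by positivity
  linarith

lemma hitting_bound (hk : 1 ≤ k) (hy : 0 ≤ y) (hn : 2 ≤ n) (hh : √n ≤ 2 * h)
    (hL : (16 * y + 40) * (k * √n * Real.log n) ≤ L) :
    Real.exp (-(h / (n * k))) ^ L ≤ n ^ (-y) := by
  have hl : 1 / 2 ≤ Real.log n := by
    linarith [Real.log_two_gt_d9, Real.log_le_log two_pos hn]
  have hs : 1 ≤ √n := Real.one_le_sqrt.mpr (by linarith)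
  have hsq : √n * √n = n := Real.mul_self_sqrt (by linarith)
  rw [← Real.exp_nat_mul, Real.rpow_def_of_pos (by linarith)]
  refine Real.exp_le_exp.mpr ?_
  have h2 : (16 * y + 40) * Real.log n * (h / √n) ≤ L * (h / (n * k)) := by
    have h3 : (16 * y + 40) * Real.log n * (h / √n) =
        (16 * y + 40) * (k * √n * Real.log n) * (h / (n * k)) := by
      generalize Real.log n = l
      generalize √n = s at hs hsq ⊢
      subst hsq
      field_simp
    rw [h3]
    gcongr
  have h4 : 1 / 2 ≤ h / √n := by
    rw [le_div_iff₀ (by linarith)]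
    linarith
  have h6 : (16 * y + 40) * Real.log n * (1 / 2) ≤ (16 * y + 40) * Real.log n * (h / √n) := by
    gcongr
  have h7 : 0 ≤ y * Real.log n := by positivity
  linarith

end Bounds

/-! ### Choice of parameters -/

theorem mainTheorem4 (a x : ℝ) :
    ∃ C : ℝ, 0 < C ∧
      ∀ (V T : Type*) [Fintype V] [Nontrivial V] [Fintype T] (G : SimpleGraph V)
        (S₀ : V → Finset T) (n k R : ℕ),
        G.Connected →
        n = Fintype.card V →
        k = Fintype.card T →
        1 ≤ k →
        (k : ℝ) ≤ (n : ℝ) ^ a →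
        (∀ t, ∃ v, t ∈ S₀ v) →
        C * (k * √(n : ℝ) * Real.log n ^ 2) ≤ R →
        (randomBroadcast 1 G S₀ R).toOuterMeasure {S | ¬ BroadcastSolved S} ≤
          ENNReal.ofReal ((n : ℝ) ^ (-x)) := by
  -- The failure bound is n^a (tokens) times n^5 (blocks) times n^(1-y), and a + 6 - y ≤ -x.
  set y : ℝ := |a + x| + 7 with hy
  have hy0 : 0 ≤ y := by positivity
  -- 14 log n bounds the number of blocks; 42 instead of 40 absorbs the rounding up of `L`.
  refine ⟨14 * (16 * y + 42), by positivity, ?_⟩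
  intro V T _ _ _ G S₀ n k R hG hn hk hk1 hka hS₀ hR
  classical
  rw [toOuterMeasure_eq_ofReal_prob]
  refine ENNReal.ofReal_le_ofReal ?_
  have hn2 : 2 ≤ n := hn ▸ Fintype.one_lt_card
  have hn2' : (2 : ℝ) ≤ n := by exact_mod_cast hn2
  have hn0 : (0 : ℝ) < n := by linarith
  have hk1' : (1 : ℝ) ≤ k := by exact_mod_cast hk1
  have hl : 1 / 2 ≤ Real.log n := by
    linarith [Real.log_two_gt_d9, Real.log_le_log two_pos hn2']
  have hln : Real.log n ≤ n := (Real.log_le_sub_one_of_pos hn0).trans (by linarith)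
  have hs : 1 ≤ √(n : ℝ) := Real.one_le_sqrt.mpr (by linarith)
  set h := Nat.sqrt n
  have hh0 : 0 < h := Nat.sqrt_pos.mpr (by omega)
  have hh1 : (h : ℝ) ≤ √n := Real.nat_sqrt_le_real_sqrt
  have hh2 : √(n : ℝ) ≤ 2 * h := by
    have h1 : √(n : ℝ) ≤ h + 1 := Real.real_sqrt_le_nat_sqrt_succ
    have h2 : (1 : ℝ) ≤ h := by exact_mod_cast hh0
    linarith
  set L := ⌈(16 * y + 40) * (k * √(n : ℝ) * Real.log n)⌉₊
  have hL : (16 * y + 40) * (k * √(n : ℝ) * Real.log n) ≤ L := Nat.le_ceil _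
  have hks : 1 ≤ k * √(n : ℝ) := one_le_mul_of_one_le_of_one_le hk1' hs
  have hL' : (L : ℝ) ≤ (16 * y + 42) * (k * √(n : ℝ) * Real.log n) := by
    have h1 : (L : ℝ) ≤ (16 * y + 40) * (k * √(n : ℝ) * Real.log n) + 1 :=
      (Nat.ceil_lt_add_one (by positivity)).le
    have h2 : 1 ≤ 2 * (k * √(n : ℝ) * Real.log n) := by nlinarith
    linarith
  -- Since 2 log 2 > 1, this gives 2^i ≥ n.
  set i := ⌈2 * Real.log n⌉₊
  have hi : 2 * Real.log n ≤ i := Nat.le_ceil _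
  have hi' : 2 * (i : ℝ) + 3 ≤ 14 * Real.log n := by
    have h1 : (i : ℝ) ≤ 2 * Real.log n + 1 := (Nat.ceil_lt_add_one (by positivity)).le
    linarith
  have hni : n ≤ 2 ^ i := by
    have h1 : Real.log n ≤ Real.log (2 ^ i) := by
      rw [Real.log_pow]
      nlinarith [Real.log_two_gt_d9]
    have h2 := (Real.log_le_log_iff hn0 (by positivity)).mp h1
    exact_mod_cast h2
  -- The extra factor `n` pays for the union bounds over nodes.
  set ε : ℝ := n * (n : ℝ) ^ (-y) with hε
  have hp0 : 0 ≤ (n : ℝ) ^ (-y) := by positivity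
  have hpε : (n : ℝ) ^ (-y) ≤ ε := le_mul_of_one_le_left hp0 (by linarith)
  have hlead (t : T) : Leads G (fun S => ∃ v, t ∈ S v) (fun S => ∀ v, t ∈ S v) ((2 * i + 3) * L)
      ((2 * i + 3) * ε) := by
    refine leads_known (h := h) hG hh0 (hn ▸ Nat.sqrt_le_self n) (hn ▸ hni) (by positivity)
      ?_ (fun m hm => ?_) ?_ <;> rw [← hn, ← hk]
    · exact mul_le_mul_of_nonneg_left (growth_bound hk1' hy0 hn2' hh1 hL) hn0.le
    · exact (seeding_bound hk1' hy0 hn2' hh2 hL hm).trans hpε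
    · exact mul_le_mul_of_nonneg_left (hitting_bound hk1' hy0 hn2' hh2 hL) hn0.le
  have hLR : (2 * i + 3) * L ≤ R := by
    have h1 : (((2 * i + 3) * L : ℕ) : ℝ) ≤ R := by
      push_cast
      calc (2 * (i : ℝ) + 3) * L
          ≤ (14 * Real.log n) * ((16 * y + 42) * (k * √(n : ℝ) * Real.log n)) := by gcongr
        _ = 14 * (16 * y + 42) * (k * √(n : ℝ) * Real.log n ^ 2) := by ring
        _ ≤ R := hR
    exact_mod_cast h1
  refine (prob_not_broadcastSolved_le hS₀ hLR hlead).trans ?_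
  rw [← hk]
  calc (k : ℝ) * ((2 * i + 3) * ε)
      ≤ (n : ℝ) ^ a * (n ^ 4 * n * ε) := by
        gcongr
        have h16 : (2 : ℝ) ^ 4 ≤ (n : ℝ) ^ 4 := by gcongr
        calc 2 * (i : ℝ) + 3 ≤ 14 * Real.log n := hi'
          _ ≤ 2 ^ 4 * n := by linarith
          _ ≤ n ^ 4 * n := by gcongr
    _ = (n : ℝ) ^ (a + 6 + -y) := by
        rw [hε, Real.rpow_add hn0, Real.rpow_add hn0, show (6 : ℝ) = (6 : ℕ) by norm_num,
          Real.rpow_natCast]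
        ring
    _ ≤ (n : ℝ) ^ (-x) := by
        refine Real.rpow_le_rpow_of_exponent_le (by linarith) ?_
        linarith [le_abs_self (a + x)]
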